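/- Let $d,k,m\in\mathbb{N}$, $T>0$, $\Omega=(-1,1)^d$ and $\mathcal{B}=\Omega\times(0,T)$. For $n,e\in\mathbb{N}$ put $A_{n,e}=\{\alpha\in\mathbb{N}^e:\|\alpha\|_\infty\le n\}$. *Grid and weights.* Let $p_0<\dots<p_n$ be the $n+1$ roots of the Legendre polynomial of degree $n+1$. For $\alpha\in A_{n,d+1}$ let $(x_\alpha,t_\alpha)=\big((p_{\alpha_1},\dots,p_{\alpha_d}),\tfrac T2(p_{\alpha_{d+1}}+1)\big)\in\mathcal{B}$ be the points of the Legendre grid of degree $n$ rescaled to $\mathcal{B}$, let $L_\alpha$ be the associated tensor-product Lagrange basis polynomials, and let $\omega_\alpha=\|L_\alpha\|_{L^2(\mathcal{B})}^2$ be the Gauss–Legendre weights. *Surrogate.* Let $T_\alpha(x,t)=\prod_{i=1}^d T_{\alpha_i}(x_i)\cdot T_{\alpha_{d+1}}(2t/T-1)$, $\alpha\in A_{k,d+1}$, be the tensor-product Chebyshev polynomials on $\mathcal{B}$. For parameters $\theta\in\mathbb{R}^{A_{k,d+1}}$, $\beta\in\mathbb{R}$, $C\in\mathbb{R}^{A_{m,d}}$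 let $Q_\theta=\sum_{\alpha\in A_{k,d+1}}\theta_\alpha T_\alpha$, let $\tilde s(x)=\sum_{\alpha\in A_{m,d}}C_\alpha x^\alpha$ be the approximate shock, let $U_-=\{(x,t):t\le\tilde s(x)\}$ and $U_+=\{(x,t):t>\tilde s(x)\}$, and let $H_{\tilde s}$ be the indicator function of $U_-$. For a function $g:\mathcal{B}\to\mathbb{R}$ the continuous reconstruction loss is $$\mathcal{L}[\theta,\beta,C]=\int_\Omega\int_0^T\big(Q_\theta(x,t)+\beta H_{\tilde s}(x,t)-g(x,t)\big)^2\,dt\,dx .$$ *Discrete loss.* Let $A^\pm_n=\{\alpha\in A_{n,d+1}:(x_\alpha,t_\alpha)\in U_\pm\}$, let $\mathbb{T}^\pm_n=\big(T_i(x_\alpha,t_\alpha)\big)_{\alpha\in A_n^\pm,\,i\in A_{k,d+1}}$ be the left and right Vandermonde matrices and $\mathbb{W}^\pm_n=\mathrm{diag}(\{\omega_\alpha\}_{\alpha\in A^\pm_n})$ the left and right weight matrices. With the residuals $$\mathfrak{r}^-_n=\mathbb{T}^-_n\theta+\beta-\big(g(x_\alpha,t_\alpha)\big)_{\alpha\in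 A^-_n},\qquad \mathfrak{r}^+_n=\mathbb{T}^+_n\theta-\big(g(x_\alpha,t_\alpha)\big)_{\alpha\in A^+_n},$$ the discrete reconstruction loss is $$\mathcal{L}^n[\theta,\beta,C]=(\mathfrak{r}^-_n)^{\mathsf T}\mathbb{W}^-_n\mathfrak{r}^-_n+(\mathfrak{r}^+_n)^{\mathsf T}\mathbb{W}^+_n\mathfrak{r}^+_n .$$ *Claim.* For every bounded continuous $g:\mathcal{B}\to\mathbb{R}$ (in particular for every $g\in C^0(\overline{\mathcal{B}})$) and all parameters $\theta,\beta,C$, the integrand of $\mathcal{L}[\theta,\beta,C]$ is integrable on $\mathcal{B}$, and $\mathcal{L}^n[\theta,\beta,C]\to\mathcal{L}[\theta,\beta,C]$ as $n\to\infty$. -/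

import Mathlib

noncomputable section

namespace HybridSurrogate

open Polynomial MeasureTheory

/-! ### The Legendre grid -/

/-- The Legendre polynomial of degree `N`, by Rodrigues' formula. -/
def legendre (N : ℕ) : ℝ[X] :=
  C ((2 ^ N * (N.factorial : ℝ))⁻¹) * derivative^[N] ((X ^ 2 - 1) ^ N)

/-- Every derivative of `(X ^ 2 - 1) ^ N` of order `k < N` has at least `k + 2` distinct real
roots: `1`, `-1`, and those given by Rolle's theorem. -/
theorem le_card_roots_iterate_derivative (N k : ℕ) (hk : k < N) :
    k + 2 ≤ (derivative^[k] ((X ^ 2 - 1 : ℝ[X]) ^ N)).roots.toFinset.card := by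
  have hroot : ∀ j < N, ∀ c : ℝ, c ^ 2 = 1 →
      (derivative^[j] ((X ^ 2 - 1 : ℝ[X]) ^ N)).IsRoot c := by
    intro j hj c hc
    have h1 : (X ^ 2 - 1 : ℝ[X]) ∣ derivative^[j] ((X ^ 2 - 1 : ℝ[X]) ^ N) :=
      (dvd_pow_self _ (by omega)).trans (pow_sub_dvd_iterate_derivative_of_pow_dvd j dvd_rfl)
    exact IsRoot.dvd (by simp [IsRoot.def, hc]) h1
  have hne : (1 : ℝ) ≠ -1 := by norm_num
  induction k with
  | zero =>
    have h0 : derivative^[0] ((X ^ 2 - 1 : ℝ[X]) ^ N) ≠ 0 := by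
      simpa using pow_ne_zero N (X_pow_sub_C_ne_zero (by norm_num) (1 : ℝ))
    have hs : ({1, -1} : Finset ℝ) ⊆
        (derivative^[0] ((X ^ 2 - 1 : ℝ[X]) ^ N)).roots.toFinset := by
      intro c hc
      rw [Multiset.mem_toFinset, mem_roots h0]
      refine hroot 0 hk c ?_
      rcases Finset.mem_insert.1 hc with rfl | hc
      · norm_num
      · rw [Finset.mem_singleton.1 hc]; norm_num
    simpa [Finset.card_pair hne] using Finset.card_le_card hs
  | succ k ih =>
    have ih := ih (by omega)
    have hR := card_roots_toFinset_le_card_roots_derivative_sdiff_roots_succ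
      (derivative^[k] ((X ^ 2 - 1 : ℝ[X]) ^ N))
    rw [← Function.iterate_succ_apply' (⇑derivative)] at hR
    set p := derivative^[k] ((X ^ 2 - 1 : ℝ[X]) ^ N) with hp
    set q := derivative^[k + 1] ((X ^ 2 - 1 : ℝ[X]) ^ N) with hq
    have hp0 : p ≠ 0 := by rintro h; simp [h] at ih
    have hq0 : q ≠ 0 := by rintro h; simp [h] at hR; omega
    have hs : ({1, -1} : Finset ℝ) ∪ (q.roots.toFinset \ p.roots.toFinset)
        ⊆ q.roots.toFinset := by
      refine Finset.union_subset ?_ Finset.sdiff_subset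
      intro c hc
      rw [Multiset.mem_toFinset, mem_roots hq0]
      refine hroot _ hk c ?_
      rcases Finset.mem_insert.1 hc with rfl | hc
      · norm_num
      · rw [Finset.mem_singleton.1 hc]; norm_num
    have hd : Disjoint ({1, -1} : Finset ℝ) (q.roots.toFinset \ p.roots.toFinset) := by
      rw [Finset.disjoint_left]
      intro c hc hc2
      refine (Finset.mem_sdiff.1 hc2).2 ?_
      rw [Multiset.mem_toFinset, mem_roots hp0]
      refine hroot _ (by omega) c ?_
      rcases Finset.mem_insert.1 hc with rfl | hc
      · norm_num
      · rw [Finset.mem_singleton.1 hc]; norm_num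
    have h3 := Finset.card_le_card hs
    rw [Finset.card_union_of_disjoint hd, Finset.card_pair hne] at h3
    omega

/-- The Legendre polynomial of degree `n + 1` has exactly `n + 1` distinct real roots. -/
theorem card_roots_legendre (n : ℕ) : (legendre (n + 1)).roots.toFinset.card = n + 1 := by
  have hc : ((2 ^ (n + 1) * ((n + 1).factorial : ℝ))⁻¹) ≠ 0 := by positivity
  rw [legendre, roots_C_mul _ hc]
  apply le_antisymm
  · refine (Multiset.toFinset_card_le _).trans ((card_roots' _).trans
      ((natDegree_iterate_derivative _ _).trans ?_))
    have h2 : (X ^ 2 - 1 : ℝ[X]).natDegree = 2 := natDegree_X_pow_sub_C (r := (1 : ℝ))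
    rw [natDegree_pow, h2]
    omega
  · have h1 := le_card_roots_iterate_derivative (n + 1) n (Nat.lt_succ_self n)
    have hR := card_roots_toFinset_le_card_roots_derivative_sdiff_roots_succ
      (derivative^[n] ((X ^ 2 - 1 : ℝ[X]) ^ (n + 1)))
    rw [← Function.iterate_succ_apply' (⇑derivative)] at hR
    have h3 := Finset.card_le_card (Finset.sdiff_subset
      (s := (derivative^[n + 1] ((X ^ 2 - 1 : ℝ[X]) ^ (n + 1))).roots.toFinset)
      (t := (derivative^[n] ((X ^ 2 - 1 : ℝ[X]) ^ (n + 1))).roots.toFinset))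
    have h4 := hR
    simp only [Nat.succ_eq_add_one] at h4
    omega

/-- The `n + 1` Legendre nodes of degree `n` on `(-1, 1)`: the roots of the Legendre polynomial of
degree `n + 1`, in increasing order. -/
def legendreNode (n : ℕ) : Fin (n + 1) ↪o ℝ :=
  (legendre (n + 1)).roots.toFinset.orderEmbOfFin (card_roots_legendre n)

/-- The Legendre nodes rescaled to `(0, T)`. -/
def timeNode (T : ℝ) (n : ℕ) (j : Fin (n + 1)) : ℝ :=
  T / 2 * (legendreNode n j + 1)

/-- The multi-indices `α ∈ ℕ^d` with `‖α‖_∞ ≤ n`. -/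
abbrev MultiIndex (n d : ℕ) : Type := Fin d → Fin (n + 1)

/-- The space-time points `(x, t)` with `x ∈ ℝ^d`. -/
abbrev SpaceTime (d : ℕ) : Type := (Fin d → ℝ) × ℝ

/-- The spatial domain `Ω = (-1, 1)^d`. -/
def spatialDomain (d : ℕ) : Set (Fin d → ℝ) := {x | ∀ i, x i ∈ Set.Ioo (-1 : ℝ) 1}

/-- The space-time domain `Ω × (0, T)`. -/
def domain (d : ℕ) (T : ℝ) : Set (SpaceTime d) := spatialDomain d ×ˢ Set.Ioo 0 T

/-- The grid point `(x_α, t_α)` of the Legendre grid of degree `n` on `Ω × (0, T)`. -/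
def gridPoint {d : ℕ} (T : ℝ) (n : ℕ) (α : MultiIndex n (d + 1)) : SpaceTime d :=
  (fun i => legendreNode n (α i.castSucc), timeNode T n (α (Fin.last d)))

/-- The tensor-product Lagrange basis polynomial `L_α` of the Legendre grid on `Ω × (0, T)`. -/
def lagrangeBasis {d : ℕ} (T : ℝ) (n : ℕ) (α : MultiIndex n (d + 1)) (p : SpaceTime d) : ℝ :=
  (∏ i : Fin d, (Lagrange.basis Finset.univ (legendreNode n) (α i.castSucc)).eval (p.1 i)) *
    (Lagrange.basis Finset.univ (timeNode T n) (α (Fin.last d))).eval p.2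

/-- The Legendre weight `ω_α = ‖L_α‖²` in `L²(Ω × (0, T))`. -/
def legendreWeight {d : ℕ} (T : ℝ) (n : ℕ) (α : MultiIndex n (d + 1)) : ℝ :=
  ∫ p in domain d T, lagrangeBasis T n α p ^ 2

/-! ### The hybrid surrogate model with one jump -/

/-- The tensor-product Chebyshev polynomial `T_α` on `Ω × (0, T)`; the time variable is rescaled
from `(0, T)` to `(-1, 1)`. -/
def chebyshevBasis {k d : ℕ} (T : ℝ) (α : MultiIndex k (d + 1)) (p : SpaceTime d) : ℝ :=
  (∏ i : Fin d, (Chebyshev.T ℝ ((α i.castSucc : ℕ) : ℤ)).eval (p.1 i)) *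
    (Chebyshev.T ℝ ((α (Fin.last d) : ℕ) : ℤ)).eval (2 * p.2 / T - 1)

/-- The smooth part `Q_θ` of the surrogate. -/
def smoothPart {k d : ℕ} (T : ℝ) (θ : MultiIndex k (d + 1) → ℝ) (p : SpaceTime d) : ℝ :=
  ∑ α, θ α * chebyshevBasis T α p

/-- The polynomial `s̃` parametrizing the approximate shock, with coefficients `C` in the canonical
basis. -/
def shock {m d : ℕ} (C : MultiIndex m d → ℝ) (x : Fin d → ℝ) : ℝ :=
  ∑ α, C α * ∏ i, x i ^ (α i : ℕ)

/-- `U₋`, the points with `t ≤ s̃(x)`. -/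
def leftRegion {m d : ℕ} (C : MultiIndex m d → ℝ) : Set (SpaceTime d) := {p | p.2 ≤ shock C p.1}

/-- `U₊`, the points with `t > s̃(x)`. -/
def rightRegion {m d : ℕ} (C : MultiIndex m d → ℝ) : Set (SpaceTime d) := {p | shock C p.1 < p.2}

/-- The Heaviside function of the approximate shock: `1` on `U₋` and `0` elsewhere. -/
def heaviside {m d : ℕ} (C : MultiIndex m d → ℝ) : SpaceTime d → ℝ :=
  (leftRegion C).indicator 1

/-- The hybrid surrogate model `ψ = Q_θ + β H_s̃`. -/
def hybridSurrogate {k m d : ℕ} (T : ℝ) (θ : MultiIndex k (d + 1) → ℝ) (β : ℝ)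
    (C : MultiIndex m d → ℝ) (p : SpaceTime d) : ℝ :=
  smoothPart T θ p + β * heaviside C p

/-- The continuous reconstruction loss
`∫_Ω ∫_0^T (Q_θ(x,t) + β H_s̃(x,t) - g(x,t))² dt dx`. -/
def loss {k m d : ℕ} (T : ℝ) (g : SpaceTime d → ℝ) (θ : MultiIndex k (d + 1) → ℝ) (β : ℝ)
    (C : MultiIndex m d → ℝ) : ℝ :=
  ∫ x in spatialDomain d, ∫ t in Set.Ioo 0 T, (hybridSurrogate T θ β C (x, t) - g (x, t)) ^ 2

/-! ### The discrete reconstruction loss -/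

/-- The multi-indices of degree `n` whose grid points lie in the region `U`. -/
abbrev RegionIndex {d : ℕ} (T : ℝ) (n : ℕ) (U : Set (SpaceTime d)) : Type :=
  {α : MultiIndex n (d + 1) // gridPoint T n α ∈ U}

instance regionIndexFintype {d : ℕ} (T : ℝ) (n : ℕ) (U : Set (SpaceTime d)) :
    Fintype (RegionIndex T n U) :=
  Fintype.ofFinite _

/-- The Vandermonde matrix of the Chebyshev basis of degree `k` on the grid points in `U`. -/
def vandermonde {d : ℕ} (T : ℝ) (k n : ℕ) (U : Set (SpaceTime d)) :
    Matrix (RegionIndex T n U) (MultiIndex k (d + 1)) ℝ :=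
  Matrix.of fun α i => chebyshevBasis T i (gridPoint T n α.1)

/-- The diagonal matrix of the Legendre weights of the grid points in `U`. -/
def weightMatrix {d : ℕ} (T : ℝ) (n : ℕ) (U : Set (SpaceTime d)) :
    Matrix (RegionIndex T n U) (RegionIndex T n U) ℝ :=
  Matrix.diagonal fun α => legendreWeight T n α.1

/-- The vector of residuals `𝕋 θ + b - g` on the grid points in `U`. -/
def residual {k d : ℕ} (T : ℝ) (g : SpaceTime d → ℝ) (n : ℕ) (U : Set (SpaceTime d))
    (θ : MultiIndex k (d + 1) → ℝ) (b : ℝ) : RegionIndex T n U → ℝ :=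
  (vandermonde T k n U).mulVec θ + (fun _ => b) - fun α => g (gridPoint T n α.1)

/-- The quadratic form `rᵀ 𝕎 r` of the weights of the grid points in `U`. -/
def weightedForm {d : ℕ} (T : ℝ) (n : ℕ) (U : Set (SpaceTime d)) (r : RegionIndex T n U → ℝ) : ℝ :=
  r ⬝ᵥ (weightMatrix T n U).mulVec r

/-- The discrete reconstruction loss on the Legendre grid of degree `n`; the jump height `β` enters
the residual on the left of the shock only. -/
def discreteLoss {k m d : ℕ} (T : ℝ) (g : SpaceTime d → ℝ) (n : ℕ)
    (θ : MultiIndex k (d + 1) → ℝ) (β : ℝ) (C : MultiIndex m d → ℝ) : ℝ :=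
  weightedForm T n (leftRegion C) (residual T g n (leftRegion C) θ β) +
    weightedForm T n (rightRegion C) (residual T g n (rightRegion C) θ 0)

end HybridSurrogate

end

/-! Normalized by the volume of `Ω × (0, T)`, the Gauss–Legendre weights form a probability measure
on the grid, and the discrete loss is a multiple of the integral of `(ψ - g) ^ 2` against it. In one
dimension, Gaussian quadrature is exact on polynomials of degree at most `2 * n + 1`, so the moments
converge to those of the uniform distribution on `(-1, 1)`, and by Weierstrass approximation the
measures converge weakly. Products and affine images inherit weak convergence, so the grid measures
converge weakly to the uniform distribution on `Ω × (0, T)`. The function `(ψ - g) ^ 2` is bounded,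
and its discontinuities lie on the graph of the shock or are discontinuities of `g`, hence form a
null set; by the Mann–Wald theorem its integrals converge as well. -/

noncomputable section

namespace HybridSurrogate

open Polynomial MeasureTheory Filter Topology ProbabilityTheory
open scoped BoundedContinuousFunction

/-! ### Weak convergence of probability measures -/

theorem aemeasurable_map_of_countable {ι X Y : Type*} [Countable ι] [MeasurableSpace ι]
    [MeasurableSpace X] [MeasurableSingletonClass X] [MeasurableSpace Y] (μ : Measure ι)
    {φ : ι → X} (hφ : Measurable φ) (f : X → Y) : AEMeasurable f (μ.map φ) := by
  have hrange : MeasurableSet (Set.range φ) := (Set.countable_range φ).measurableSet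
  have hmem : ∀ᵐ x ∂μ.map φ, x ∈ Set.range φ :=
    (ae_map_iff hφ.aemeasurable hrange).2 (ae_of_all _ Set.mem_range_self)
  rw [← Measure.restrict_eq_self_of_ae_mem hmem]
  have : Countable (Set.range φ) := Set.countable_range φ
  exact aemeasurable_restrict_of_measurable_subtype hrange (measurable_of_countable _)

theorem aemeasurable_of_ae_continuousAt {X Y : Type*} [TopologicalSpace X] [MeasurableSpace X]
    [OpensMeasurableSpace X] [TopologicalSpace Y] [TopologicalSpace.PseudoMetrizableSpace Y]
    [MeasurableSpace Y] [BorelSpace Y] {μ : Measure X} {f : X → Y}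
    (hf : ∀ᵐ x ∂μ, ContinuousAt f x) : AEMeasurable f μ := by
  rw [← Measure.restrict_eq_self_of_ae_mem hf]
  exact ContinuousOn.aemeasurable (fun x hx => ContinuousAt.continuousWithinAt hx)
    (IsGδ.setOfPred_continuousAt f).measurableSet

theorem integrableOn_of_ae_continuousAt {X : Type*} [TopologicalSpace X] [MeasurableSpace X]
    [OpensMeasurableSpace X] {μ : Measure X} {s : Set X} (hs : MeasurableSet s) (hμs : μ s ≠ ⊤)
    {f : X → ℝ} {M : ℝ} (hf : ∀ᵐ x ∂μ.restrict s, ContinuousAt f x) (hM : ∀ x ∈ s, |f x| ≤ M) :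
    IntegrableOn f s μ :=
  .of_bound hμs.lt_top (aemeasurable_of_ae_continuousAt hf).aestronglyMeasurable M
    (ae_restrict_of_forall_mem hs hM)

/-- The Mann–Wald continuous mapping theorem. -/
theorem tendsto_map_of_tendsto_of_ae_continuousAt {ι X Y : Type*} {l : Filter ι}
    [l.IsCountablyGenerated] [TopologicalSpace X] [MeasurableSpace X] [OpensMeasurableSpace X]
    [HasOuterApproxClosed X] [TopologicalSpace Y] [MeasurableSpace Y] [OpensMeasurableSpace Y]
    {P : ι → ProbabilityMeasure X} {μ : ProbabilityMeasure X} (hP : Tendsto P l (𝓝 μ))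
    {f : X → Y} (hfP : ∀ i, AEMeasurable f (P i : Measure X)) (hfμ : AEMeasurable f (μ : Measure X))
    (hf : ∀ᵐ x ∂(μ : Measure X), ContinuousAt f x) :
    Tendsto (fun i => (P i).map (hfP i)) l (𝓝 (μ.map hfμ)) := by
  refine tendsto_of_forall_isClosed_limsup_le' fun F hF => ?_
  have hclosure : closure (f ⁻¹' F) ≤ᵐ[(μ : Measure X)] f ⁻¹' F := by
    filter_upwards [hf] with x hx hxF
    exact hF.closure_subset_iff.2 (Set.image_preimage_subset f F)
      (hx.continuousWithinAt.mem_closure_image hxF)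
  calc limsup (fun i => ((P i).map (hfP i) : Measure Y) F) l
      ≤ limsup (fun i => (P i : Measure X) (closure (f ⁻¹' F))) l :=
        limsup_le_limsup (.of_forall fun i =>
          (ProbabilityMeasure.map_apply' _ (hfP i) hF.measurableSet).trans_le
            (measure_mono subset_closure))
    _ ≤ (μ : Measure X) (closure (f ⁻¹' F)) :=
        ProbabilityMeasure.limsup_measure_closed_le_of_tendsto hP isClosed_closure
    _ ≤ (μ : Measure X) (f ⁻¹' F) := measure_mono_ae hclosure
    _ = (μ.map hfμ : Measure Y) F :=
        (ProbabilityMeasure.map_apply' _ hfμ hF.measurableSet).symm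

theorem tendsto_integral_of_tendsto_of_ae_continuousAt {ι X : Type*} {l : Filter ι}
    [l.IsCountablyGenerated] [TopologicalSpace X] [MeasurableSpace X] [OpensMeasurableSpace X]
    [HasOuterApproxClosed X] {P : ι → ProbabilityMeasure X} {μ : ProbabilityMeasure X}
    (hP : Tendsto P l (𝓝 μ)) {f : X → ℝ} {M : ℝ}
    (hfP : ∀ i, AEMeasurable f (P i : Measure X)) (hf : ∀ᵐ x ∂(μ : Measure X), ContinuousAt f x)
    (hMP : ∀ i, ∀ᵐ x ∂(P i : Measure X), |f x| ≤ M) (hMμ : ∀ᵐ x ∂(μ : Measure X), |f x| ≤ M) :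
    Tendsto (fun i => ∫ x, f x ∂(P i : Measure X)) l (𝓝 (∫ x, f x ∂(μ : Measure X))) := by
  have hM : -M ≤ M := by
    obtain ⟨x, hx⟩ := hMμ.exists
    linarith [(abs_le.1 hx).1, (abs_le.1 hx).2]
  let clamp : ℝ →ᵇ ℝ := .ofNormedAddCommGroup (fun y => (Set.projIcc (-M) M hM y : ℝ))
    (continuous_subtype_val.comp continuous_projIcc) M
    fun y => abs_le.2 (Set.projIcc (-M) M hM y).2
  have hclamp {ν : ProbabilityMeasure X} (hfν : AEMeasurable f (ν : Measure X))
      (hMν : ∀ᵐ x ∂(ν : Measure X), |f x| ≤ M) :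
      ∫ y, clamp y ∂(ν.map hfν : Measure ℝ) = ∫ x, f x ∂(ν : Measure X) := by
    rw [ProbabilityMeasure.toMeasure_map,
      integral_map hfν clamp.continuous.aestronglyMeasurable]
    refine integral_congr_ae (hMν.mono fun x hx => ?_)
    exact congrArg Subtype.val (Set.projIcc_of_mem hM (abs_le.1 hx))
  have hfμ := aemeasurable_of_ae_continuousAt hf
  have h := ProbabilityMeasure.tendsto_iff_forall_integral_tendsto.1
    (tendsto_map_of_tendsto_of_ae_continuousAt hP hfP hfμ hf) clamp
  simpa only [hclamp (hfP _) (hMP _), hclamp hfμ hMμ] using h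

theorem abs_integral_sub_integral_le {X : Type*} [MeasurableSpace X] {μ : Measure X}
    [IsProbabilityMeasure μ] {f g : X → ℝ} {ε : ℝ} (hf : Integrable f μ) (hg : Integrable g μ)
    (h : ∀ᵐ x ∂μ, |f x - g x| ≤ ε) : |∫ x, f x ∂μ - ∫ x, g x ∂μ| ≤ ε := by
  rw [← integral_sub hf hg]
  simpa using norm_integral_le_of_norm_le_const (f := fun x => f x - g x) h

theorem integrable_of_ae_mem_isCompact {X : Type*} [TopologicalSpace X] [T2Space X]
    [MeasurableSpace X] [OpensMeasurableSpace X]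
    {μ : Measure X} [IsFiniteMeasure μ] {K : Set X} (hK : IsCompact K) (hμ : ∀ᵐ x ∂μ, x ∈ K)
    {f : X → ℝ} (hf : ContinuousOn f K) : Integrable f μ := by
  rw [← Measure.restrict_eq_self_of_ae_mem hμ]
  exact hf.integrableOn_compact' hK hK.measurableSet

theorem tendsto_of_forall_integral_eval_tendsto {ι : Type*} {l : Filter ι} {a b : ℝ}
    {P : ι → ProbabilityMeasure ℝ} {μ : ProbabilityMeasure ℝ}
    (hP : ∀ i, ∀ᵐ x ∂(P i : Measure ℝ), x ∈ Set.Icc a b)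
    (hμ : ∀ᵐ x ∂(μ : Measure ℝ), x ∈ Set.Icc a b)
    (h : ∀ p : ℝ[X], Tendsto (fun i => ∫ x, p.eval x ∂(P i : Measure ℝ)) l
      (𝓝 (∫ x, p.eval x ∂(μ : Measure ℝ)))) :
    Tendsto P l (𝓝 μ) := by
  refine ProbabilityMeasure.tendsto_iff_forall_integral_tendsto.2 fun f => ?_
  refine Metric.tendsto_nhds.2 fun ε hε => ?_
  obtain ⟨p, hp⟩ := exists_polynomial_near_of_continuousOn a b f f.continuous.continuousOn
    (ε / 3) (by positivity)
  have happrox {ν : ProbabilityMeasure ℝ} (hν : ∀ᵐ x ∂(ν : Measure ℝ), x ∈ Set.Icc a b) :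
      |∫ x, p.eval x ∂(ν : Measure ℝ) - ∫ x, f x ∂(ν : Measure ℝ)| ≤ ε / 3 :=
    abs_integral_sub_integral_le
      (integrable_of_ae_mem_isCompact isCompact_Icc hν p.continuous.continuousOn)
      (integrable_of_ae_mem_isCompact isCompact_Icc hν f.continuous.continuousOn)
      (hν.mono fun x hx => (hp x hx).le)
  filter_upwards [Metric.tendsto_nhds.1 (h p) (ε / 3) (by positivity)] with i hi
  rw [Real.dist_eq] at hi ⊢
  have hPi := abs_le.1 (happrox (hP i))
  have hμ' := abs_le.1 (happrox hμ)
  have hi' := abs_lt.1 hi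
  exact abs_lt.2 ⟨by linarith, by linarith⟩

/-! ### Gaussian quadrature -/

section GaussianQuadrature

variable {K ι : Type*} [Field K] [DecidableEq ι] {s : Finset ι} {v : ι → K}

theorem degree_div_lt_of_natDegree_lt_two_mul {P f : K[X]} {N : ℕ} (hP : P.degree = N)
    (hf : f.natDegree < 2 * N) : (f / P).degree < N := by
  rcases eq_or_ne (f / P) 0 with h0 | h0
  · simp [h0]
  have hP0 : P ≠ 0 := by
    rintro rfl
    simp at hP
  have hdeg : P.degree ≤ f.degree := not_lt.1 fun h => h0 ((Polynomial.div_eq_zero_iff hP0).2 h)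
  have hadd : P.natDegree + (f / P).natDegree = f.natDegree := by
    rw [← natDegree_mul hP0 h0]
    exact natDegree_eq_of_degree_eq (by rw [degree_mul, degree_add_div hP0 hdeg])
  rw [natDegree_eq_of_degree_eq_some hP] at hadd
  rw [degree_eq_natDegree h0]
  exact_mod_cast (by lia : (f / P).natDegree < N)

variable {P : K[X]} {Λ : K[X] →ₗ[K] K}

/-- Division by `P` reduces the claim to interpolation, as `Λ` kills the part divisible by `P`. -/
theorem quadrature_eq_sum_basis (hv : Set.InjOn v s) (hP : P.degree = s.card)
    (hroot : ∀ i ∈ s, P.eval (v i) = 0)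
    (horth : ∀ q : K[X], q.degree < s.card → Λ (P * q) = 0) {f : K[X]}
    (hf : f.natDegree < 2 * s.card) :
    Λ f = ∑ i ∈ s, Λ (Lagrange.basis s v i) * f.eval (v i) := by
  have hdiv : P * (f / P) + f % P = f := EuclideanDomain.div_add_mod f P
  have hP0 : P ≠ 0 := by
    rintro rfl
    simp at hP
  have heval : ∀ i ∈ s, (f % P).eval (v i) = f.eval (v i) := fun i hi => by
    conv_rhs => rw [← hdiv, eval_add, eval_mul, hroot i hi, zero_mul, zero_add]
  have hmod : f % P = ∑ i ∈ s, f.eval (v i) • Lagrange.basis s v i := by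
    rw [Lagrange.eq_interpolate_of_eval_eq _ hv (hP ▸ EuclideanDomain.mod_lt f hP0) heval,
      Lagrange.interpolate_apply]
    simp only [smul_eq_C_mul]
  calc Λ f = Λ (P * (f / P)) + Λ (f % P) := by rw [← map_add, hdiv]
    _ = ∑ i ∈ s, Λ (Lagrange.basis s v i) * f.eval (v i) := by
        rw [horth _ (degree_div_lt_of_natDegree_lt_two_mul hP hf), zero_add, hmod, map_sum]
        simp only [map_smul, smul_eq_mul, mul_comm]

theorem natDegree_basis_sq (hv : Set.InjOn v s) {i : ι} (hi : i ∈ s) :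
    (Lagrange.basis s v i ^ 2).natDegree = 2 * (s.card - 1) := by
  rw [natDegree_pow, Lagrange.natDegree_basis hv hi]

theorem quadrature_basis_sq (hv : Set.InjOn v s) (hP : P.degree = s.card)
    (hroot : ∀ i ∈ s, P.eval (v i) = 0)
    (horth : ∀ q : K[X], q.degree < s.card → Λ (P * q) = 0) {i : ι} (hi : i ∈ s) :
    Λ (Lagrange.basis s v i ^ 2) = Λ (Lagrange.basis s v i) := by
  have hdeg : (Lagrange.basis s v i ^ 2).natDegree < 2 * s.card := by
    have := Finset.card_pos.2 ⟨i, hi⟩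
    rw [natDegree_basis_sq hv hi]
    lia
  rw [quadrature_eq_sum_basis hv hP hroot horth hdeg,
    Finset.sum_eq_single_of_mem i hi fun j hj hji => by
      rw [eval_pow, Lagrange.eval_basis_of_ne hji.symm hj, zero_pow two_ne_zero, mul_zero],
    eval_pow, Lagrange.eval_basis_self hv hi, one_pow, mul_one]

theorem quadrature_eq_sum_basis_sq (hv : Set.InjOn v s) (hP : P.degree = s.card)
    (hroot : ∀ i ∈ s, P.eval (v i) = 0)
    (horth : ∀ q : K[X], q.degree < s.card → Λ (P * q) = 0) {f : K[X]}
    (hf : f.natDegree < 2 * s.card) :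
    Λ f = ∑ i ∈ s, Λ (Lagrange.basis s v i ^ 2) * f.eval (v i) := by
  rw [quadrature_eq_sum_basis hv hP hroot horth hf]
  exact Finset.sum_congr rfl fun i hi => by rw [quadrature_basis_sq hv hP hroot horth hi]

theorem eval_basis_affine (s : Finset ι) (v : ι → K) (j : ι) {a : K} (ha : a ≠ 0) (b x : K) :
    (Lagrange.basis s (fun i => a * v i + b) j).eval (a * x + b) =
      (Lagrange.basis s v j).eval x := by
  simp only [Lagrange.basis, eval_prod, Lagrange.basisDivisor, eval_mul, eval_sub, eval_X, eval_C,
    add_sub_add_right_eq_sub, ← mul_sub, mul_inv]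
  refine Finset.prod_congr rfl fun i _ => ?_
  field_simp

end GaussianQuadrature

/-! ### Legendre polynomials -/

theorem integral_eval_derivative_mul (u q : ℝ[X]) (a b : ℝ) :
    ∫ x in a..b, (derivative u * q).eval x =
      (u * q).eval b - (u * q).eval a - ∫ x in a..b, (u * derivative q).eval x := by
  simpa only [eval_mul, mul_comm] using intervalIntegral.integral_mul_deriv_eq_deriv_mul
    (fun x _ => q.hasDerivAt x) (fun x _ => u.hasDerivAt x)
    ((derivative q).continuous.intervalIntegrable a b)
    ((derivative u).continuous.intervalIntegrable a b)

theorem integral_iterate_derivative_mul_eq_zero {u : ℝ[X]} {a b : ℝ} {N : ℕ}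
    (ha : ∀ j < N, (derivative^[j] u).eval a = 0) (hb : ∀ j < N, (derivative^[j] u).eval b = 0)
    {q : ℝ[X]} (hq : q.degree < N) : ∫ x in a..b, (derivative^[N] u * q).eval x = 0 := by
  induction N generalizing q with
  | zero => simp [degree_eq_bot.1 (Nat.WithBot.lt_zero_iff.1 hq)]
  | succ N ih =>
    have hq' : (derivative q).degree < N := (degree_lt_iff_coeff_zero _ _).2 fun m hm => by
      rw [coeff_derivative, (degree_lt_iff_coeff_zero _ _).1 hq _ (by gcongr), zero_mul]
    rw [Function.iterate_succ_apply', integral_eval_derivative_mul, eval_mul, eval_mul,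
      ha N N.lt_succ_self, hb N N.lt_succ_self,
      ih (fun j hj => ha j (hj.trans N.lt_succ_self)) (fun j hj => hb j (hj.trans N.lt_succ_self))
        hq']
    ring

theorem eval_iterate_derivative_pow_eq_zero {R : Type*} [CommRing R] {p : R[X]} {c : R}
    (hc : p.eval c = 0) {N j : ℕ} (hj : j < N) : (derivative^[j] (p ^ N)).eval c = 0 := by
  have hdvd : p ∣ derivative^[j] (p ^ N) :=
    (dvd_pow_self p (Nat.sub_ne_zero_of_lt hj)).trans
      (pow_sub_dvd_iterate_derivative_of_pow_dvd j dvd_rfl)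
  exact eval_eq_zero_of_dvd_of_eval_eq_zero hdvd hc

theorem integral_legendre_mul_eq_zero {N : ℕ} {q : ℝ[X]} (hq : q.degree < N) :
    ∫ x in (-1 : ℝ)..1, (legendre N * q).eval x = 0 := by
  simp only [legendre, mul_assoc, eval_C_mul, intervalIntegral.integral_const_mul]
  rw [integral_iterate_derivative_mul_eq_zero
    (fun j hj => eval_iterate_derivative_pow_eq_zero (by simp) hj)
    (fun j hj => eval_iterate_derivative_pow_eq_zero (by simp) hj) hq, mul_zero]

theorem degree_legendre_succ (n : ℕ) : (legendre (n + 1)).degree = (n + 1 : ℕ) := by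
  have hcard := card_roots_legendre n
  have h0 : legendre (n + 1) ≠ 0 := by
    intro h
    simp [h] at hcard
  have hle : (legendre (n + 1)).natDegree ≤ n + 1 :=
    calc (legendre (n + 1)).natDegree
        ≤ (derivative^[n + 1] ((X ^ 2 - 1 : ℝ[X]) ^ (n + 1))).natDegree := natDegree_C_mul_le _ _
      _ ≤ ((X ^ 2 - 1 : ℝ[X]) ^ (n + 1)).natDegree - (n + 1) := natDegree_iterate_derivative _ _
      _ = n + 1 := by rw [natDegree_pow, ← C_1, natDegree_X_pow_sub_C]; lia
  have hge : n + 1 ≤ (legendre (n + 1)).natDegree :=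
    hcard.ge.trans ((Multiset.toFinset_card_le _).trans (card_roots' _))
  rw [degree_eq_natDegree h0, hle.antisymm hge]

theorem eval_legendre_legendreNode (n : ℕ) (j : Fin (n + 1)) :
    (legendre (n + 1)).eval (legendreNode n j) = 0 :=
  (mem_roots'.1 (Multiset.mem_toFinset.1 (Finset.orderEmbOfFin_mem _ _ j))).2

/-! ### The Gauss–Legendre laws -/

theorem measureReal_mul_integral_cond {X : Type*} [MeasurableSpace X] {μ : Measure X} {s : Set X}
    (h0 : μ s ≠ 0) (htop : μ s ≠ ⊤) (f : X → ℝ) :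
    μ.real s * ∫ x, f x ∂μ[|s] = ∫ x in s, f x ∂μ := by
  rw [ProbabilityTheory.cond, integral_smul_measure, ENNReal.toReal_inv, smul_eq_mul,
    ← measureReal_def, mul_inv_cancel_left₀ ((measureReal_ne_zero_iff htop).2 h0)]

/-- The uniform distribution on `(-1, 1)`. -/
def uniformLaw : ProbabilityMeasure ℝ :=
  ⟨volume[|Set.Ioo (-1) 1], cond_isProbabilityMeasure_of_finite (by simp) (by simp)⟩

theorem integral_uniformLaw (f : ℝ → ℝ) :
    ∫ x, f x ∂(uniformLaw : Measure ℝ) = 2⁻¹ * ∫ x in (-1 : ℝ)..1, f x := by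
  have hvolume : volume.real (Set.Ioo (-1 : ℝ) 1) = 2 := by norm_num
  rw [intervalIntegral.integral_of_le (by norm_num), integral_Ioc_eq_integral_Ioo,
    ← measureReal_mul_integral_cond (by simp) (by simp), hvolume,
    inv_mul_cancel_left₀ two_ne_zero]
  rfl

theorem ae_uniformLaw_mem_Ioo : ∀ᵐ x ∂(uniformLaw : Measure ℝ), x ∈ Set.Ioo (-1 : ℝ) 1 :=
  ae_cond_mem measurableSet_Ioo

theorem ae_uniformLaw_mem_Icc : ∀ᵐ x ∂(uniformLaw : Measure ℝ), x ∈ Set.Icc (-1 : ℝ) 1 :=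
  ae_uniformLaw_mem_Ioo.mono fun _ hx => Set.Ioo_subset_Icc_self hx

theorem integrable_eval_uniformLaw (p : ℝ[X]) :
    Integrable (fun x => p.eval x) (uniformLaw : Measure ℝ) :=
  integrable_of_ae_mem_isCompact isCompact_Icc ae_uniformLaw_mem_Icc p.continuous.continuousOn

/-- The mean value of a polynomial under the uniform distribution on `(-1, 1)`, as a linear
functional. -/
def uniformMean : ℝ[X] →ₗ[ℝ] ℝ where
  toFun p := ∫ x, p.eval x ∂(uniformLaw : Measure ℝ)
  map_add' p q := by
    simp only [eval_add]
    exact integral_add (integrable_eval_uniformLaw p) (integrable_eval_uniformLaw q)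
  map_smul' c p := by
    simp only [eval_smul]
    exact integral_smul c _

theorem uniformMean_one : uniformMean 1 = 1 := by simp [uniformMean]

theorem uniformMean_pos {p : ℝ[X]} (hp : p ≠ 0) (hnonneg : ∀ x ∈ Set.Ioo (-1 : ℝ) 1, 0 ≤ p.eval x) :
    0 < uniformMean p := by
  have hae : ∀ᵐ x ∂(uniformLaw : Measure ℝ), 0 ≤ p.eval x :=
    ae_uniformLaw_mem_Ioo.mono hnonneg
  refine (integral_nonneg_of_ae hae).lt_of_ne' fun h => ?_
  have hzero := (integral_eq_zero_iff_of_nonneg_ae hae (integrable_eval_uniformLaw p)).1 h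
  have hne : ∀ᵐ x ∂(uniformLaw : Measure ℝ), p.eval x ≠ 0 := by
    refine cond_absolutelyContinuous.ae_le ?_
    filter_upwards [p.roots.toFinset.finite_toSet.countable.ae_notMem volume] with x hx h
    exact hx (by simpa using ⟨hp, h⟩)
  obtain ⟨x, hx, hx'⟩ := (hzero.and hne).exists
  exact hx' hx

/-- The Gauss–Legendre weight of the `j`-th node, normalized to total mass one. -/
def nodeWeight (n : ℕ) (j : Fin (n + 1)) : ℝ :=
  uniformMean (Lagrange.basis Finset.univ (legendreNode n) j ^ 2)

theorem uniformMean_eq_sum_nodeWeight {n : ℕ} {f : ℝ[X]} (hf : f.natDegree ≤ 2 * n + 1) :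
    uniformMean f = ∑ j, nodeWeight n j * f.eval (legendreNode n j) := by
  refine quadrature_eq_sum_basis_sq (P := legendre (n + 1)) (legendreNode n).injective.injOn
    (by simpa using degree_legendre_succ n) (fun j _ => eval_legendre_legendreNode n j)
    (fun q hq => ?_) (by rw [Finset.card_fin]; lia)
  exact (integral_uniformLaw _).trans
    (by rw [integral_legendre_mul_eq_zero (by simpa using hq), mul_zero])

theorem nodeWeight_nonneg (n : ℕ) (j : Fin (n + 1)) : 0 ≤ nodeWeight n j :=
  integral_nonneg fun x => by rw [eval_pow]; exact sq_nonneg _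

theorem sum_nodeWeight (n : ℕ) : ∑ j, nodeWeight n j = 1 := by
  simpa [uniformMean_one] using (uniformMean_eq_sum_nodeWeight (n := n) (f := 1) (by simp)).symm

/-- The `j`-th node is the barycenter of the density `ℓ_j ^ 2`, `ℓ_j` the Lagrange polynomial. -/
theorem uniformMean_X_sub_C_mul_basis_sq (n : ℕ) (j : Fin (n + 1)) :
    uniformMean ((X - C (legendreNode n j)) *
      Lagrange.basis Finset.univ (legendreNode n) j ^ 2) = 0 := by
  have hinj := (legendreNode n).injective.injOn (s := (Finset.univ : Finset (Fin (n + 1))))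
  rw [uniformMean_eq_sum_nodeWeight (n := n)]
  · refine Finset.sum_eq_zero fun i _ => ?_
    rcases eq_or_ne i j with rfl | hij
    · simp
    · simp [Lagrange.eval_basis_of_ne hij.symm (Finset.mem_univ i)]
  · refine natDegree_mul_le.trans ?_
    rw [natDegree_X_sub_C, natDegree_basis_sq hinj (Finset.mem_univ j), Finset.card_fin]
    lia

theorem legendreNode_mem_Ioo (n : ℕ) (j : Fin (n + 1)) :
    legendreNode n j ∈ Set.Ioo (-1 : ℝ) 1 := by
  set ℓ := Lagrange.basis Finset.univ (legendreNode n) j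
  have hne : (X - C (legendreNode n j)) * ℓ ^ 2 ≠ 0 :=
    mul_ne_zero (X_sub_C_ne_zero _) (pow_ne_zero 2
      (Lagrange.basis_ne_zero (legendreNode n).injective.injOn (Finset.mem_univ j)))
  have hzero := uniformMean_X_sub_C_mul_basis_sq n j
  by_contra hmem
  rcases le_or_gt (legendreNode n j) (-1) with hle | hgt
  · refine (uniformMean_pos hne fun x hx => ?_).ne' hzero
    simp only [eval_mul, eval_sub, eval_X, eval_C, eval_pow]
    exact mul_nonneg (by linarith [hx.1]) (sq_nonneg _)
  · have hge : 1 ≤ legendreNode n j := not_lt.1 fun hlt => hmem ⟨hgt, hlt⟩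
    refine (uniformMean_pos (neg_ne_zero.2 hne) fun x hx => ?_).ne'
      (by rw [map_neg, hzero, neg_zero])
    simp only [eval_neg, eval_mul, eval_sub, eval_X, eval_C, eval_pow, ← neg_mul]
    exact mul_nonneg (by linarith [hx.2]) (sq_nonneg _)

/-- The Gauss–Legendre weights as a probability distribution on the indices of the nodes. -/
def nodeLaw (n : ℕ) : Measure (Fin (n + 1)) :=
  (PMF.ofFintype (fun j => ENNReal.ofReal (nodeWeight n j)) (by
    rw [← ENNReal.ofReal_sum_of_nonneg fun j _ => nodeWeight_nonneg n j, sum_nodeWeight,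
      ENNReal.ofReal_one])).toMeasure

instance (n : ℕ) : IsProbabilityMeasure (nodeLaw n) := PMF.toMeasure.isProbabilityMeasure _

theorem nodeLaw_real_singleton (n : ℕ) (j : Fin (n + 1)) :
    (nodeLaw n).real {j} = nodeWeight n j := by
  rw [measureReal_def, nodeLaw, PMF.toMeasure_apply_singleton _ _ (measurableSet_singleton j),
    PMF.ofFintype_apply, ENNReal.toReal_ofReal (nodeWeight_nonneg n j)]

theorem integral_map_of_fintype {ι X : Type*} [Fintype ι] [MeasurableSpace ι]
    [MeasurableSingletonClass ι] [MeasurableSpace X] [MeasurableSingletonClass X]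
    (μ : Measure ι) [IsFiniteMeasure μ] (φ : ι → X) (f : X → ℝ) :
    ∫ x, f x ∂(μ.map φ) = ∑ i, μ.real {i} * f (φ i) := by
  have hφ : Measurable φ := measurable_of_countable φ
  rw [integral_map hφ.aemeasurable
      (aemeasurable_map_of_countable μ hφ f).aestronglyMeasurable,
    integral_fintype .of_finite]
  simp only [smul_eq_mul]

/-- The distribution of the Legendre nodes of degree `n`, weighted by the Gauss–Legendre weights. -/
def gaussLegendreLaw (n : ℕ) : ProbabilityMeasure ℝ :=
  ⟨(nodeLaw n).map (legendreNode n),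
    Measure.isProbabilityMeasure_map (measurable_of_countable _).aemeasurable⟩

theorem integral_gaussLegendreLaw (n : ℕ) (f : ℝ → ℝ) :
    ∫ x, f x ∂(gaussLegendreLaw n : Measure ℝ) = ∑ j, nodeWeight n j * f (legendreNode n j) := by
  simp only [gaussLegendreLaw, ProbabilityMeasure.coe_mk, integral_map_of_fintype,
    nodeLaw_real_singleton]

theorem tendsto_gaussLegendreLaw : Tendsto gaussLegendreLaw atTop (𝓝 uniformLaw) := by
  refine tendsto_of_forall_integral_eval_tendsto (a := -1) (b := 1) (fun n => ?_)
    ae_uniformLaw_mem_Icc fun p => ?_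
  · exact (ae_map_iff (measurable_of_countable _).aemeasurable measurableSet_Icc).2
      (ae_of_all _ fun j => Set.Ioo_subset_Icc_self (legendreNode_mem_Ioo n j))
  · refine tendsto_const_nhds.congr' ?_
    filter_upwards [eventually_ge_atTop p.natDegree] with n hn
    rw [integral_gaussLegendreLaw]
    exact uniformMean_eq_sum_nodeWeight (by lia)

/-! ### The Legendre grid law -/

theorem cond_map {X Y : Type*} [MeasurableSpace X] [MeasurableSpace Y] (μ : Measure X) {φ : X → Y}
    (hφ : Measurable φ) {s : Set Y} (hs : MeasurableSet s) :
    (μ.map φ)[|s] = (μ[|φ ⁻¹' s]).map φ := by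
  rw [ProbabilityTheory.cond, ProbabilityTheory.cond, Measure.restrict_map hφ hs,
    Measure.map_apply hφ hs, Measure.map_smul]

theorem cond_smul {X : Type*} [MeasurableSpace X] (μ : Measure X) {c : ENNReal} (h0 : c ≠ 0)
    (htop : c ≠ ⊤) (s : Set X) : (c • μ)[|s] = μ[|s] := by
  rw [ProbabilityTheory.cond, ProbabilityTheory.cond, Measure.restrict_smul, smul_smul,
    Measure.smul_apply, smul_eq_mul, ENNReal.mul_inv (.inl h0) (.inl htop), mul_right_comm,
    ENNReal.inv_mul_cancel h0 htop, one_mul]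

theorem pi_cond {ι : Type*} [Fintype ι] {X : ι → Type*} [∀ i, MeasurableSpace (X i)]
    (μ : ∀ i, Measure (X i)) [∀ i, SigmaFinite (μ i)] {s : ∀ i, Set (X i)}
    (hs : ∀ i, MeasurableSet (s i)) (h0 : ∀ i, μ i (s i) ≠ 0) (htop : ∀ i, μ i (s i) ≠ ⊤) :
    (Measure.pi fun i => (μ i)[|s i]) = (Measure.pi μ)[|Set.univ.pi s] := by
  have (i : ι) : IsProbabilityMeasure ((μ i)[|s i]) :=
    cond_isProbabilityMeasure_of_finite (h0 i) (htop i)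
  refine Measure.pi_eq fun t _ => ?_
  simp only [cond_apply (MeasurableSet.univ_pi hs), cond_apply (hs _), ← Set.pi_inter_distrib,
    Measure.pi_pi, Finset.prod_mul_distrib]
  rw [ENNReal.prod_inv_distrib fun i _ j _ _ => .inl (h0 i)]

theorem map_volume_affine {a : ℝ} (ha : a ≠ 0) (b : ℝ) :
    (volume : Measure ℝ).map (fun x => a * x + b) = ENNReal.ofReal |a⁻¹| • volume := by
  have hcomp : (fun x : ℝ => a * x + b) = (· + b) ∘ (a * ·) := rfl
  rw [hcomp, ← Measure.map_map (measurable_add_const b) (measurable_const_mul a),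
    Real.map_volume_mul_left ha, Measure.map_smul, map_add_right_eq_self]

/-- The affine map from the reference cube `(-1, 1)^(d + 1)` onto `Ω × (0, T)`; the last coordinate
is the rescaled time. -/
def referenceMap {d : ℕ} (T : ℝ) (y : Fin (d + 1) → ℝ) : SpaceTime d :=
  (fun i => y i.castSucc, T / 2 * (y (Fin.last d) + 1))

section Grid

variable {d : ℕ} {T : ℝ}

theorem continuous_referenceMap (d : ℕ) (T : ℝ) : Continuous (referenceMap (d := d) T) := by
  unfold referenceMap
  fun_prop

theorem referenceMap_mem_domain_iff (hT : 0 < T) {y : Fin (d + 1) → ℝ} :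
    referenceMap T y ∈ domain d T ↔ ∀ i, y i ∈ Set.Ioo (-1 : ℝ) 1 := by
  have htime : T / 2 * (y (Fin.last d) + 1) ∈ Set.Ioo 0 T ↔
      y (Fin.last d) ∈ Set.Ioo (-1 : ℝ) 1 := by
    have hlt : T / 2 * (y (Fin.last d) + 1) < T ↔ y (Fin.last d) < 1 := by
      constructor <;> intro h <;> nlinarith
    have hpos : 0 < T / 2 * (y (Fin.last d) + 1) ↔ -1 < y (Fin.last d) := by
      rw [mul_pos_iff_of_pos_left (half_pos hT), neg_lt_iff_pos_add]
    exact and_congr hpos hlt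
  rw [Fin.forall_fin_succ', ← htime]
  rfl

theorem map_referenceMap_volume (d : ℕ) (hT : 0 < T) :
    (volume : Measure (Fin (d + 1) → ℝ)).map (referenceMap T) =
      ENNReal.ofReal |(T / 2)⁻¹| • (volume : Measure (SpaceTime d)) := by
  have hcomp : referenceMap (d := d) T = Prod.map id (fun t => T / 2 * t + T / 2) ∘ Prod.swap ∘
      MeasurableEquiv.piFinSuccAbove (fun _ => ℝ) (Fin.last d) := by
    ext y
    · simp [referenceMap, Fin.init]
    · simp [referenceMap, mul_add]
  have hsplit : MeasurePreserving (Prod.swap ∘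
      MeasurableEquiv.piFinSuccAbove (fun _ : Fin (d + 1) => ℝ) (Fin.last d)) :=
    Measure.measurePreserving_swap.comp (volume_preserving_piFinSuccAbove _ _)
  have haffine : Measurable fun t : ℝ => T / 2 * t + T / 2 := by fun_prop
  rw [hcomp, ← Measure.map_map (measurable_id.prodMap haffine) hsplit.measurable, hsplit.map_eq,
    Measure.volume_eq_prod, ← Measure.map_prod_map _ _ measurable_id haffine, Measure.map_id,
    map_volume_affine (half_pos hT).ne', Measure.prod_smul_right]

theorem spatialDomain_eq_pi (d : ℕ) :
    spatialDomain d = Set.univ.pi fun _ => Set.Ioo (-1 : ℝ) 1 := by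
  ext x
  simp only [spatialDomain, Set.mem_ofPred_eq, Set.mem_univ_pi]

theorem isOpen_domain (d : ℕ) (T : ℝ) : IsOpen (domain d T) := by
  rw [domain, spatialDomain_eq_pi]
  exact (isOpen_set_pi Set.finite_univ fun _ _ => isOpen_Ioo).prod isOpen_Ioo

theorem domain_nonempty (d : ℕ) (hT : 0 < T) : (domain d T).Nonempty :=
  ⟨referenceMap T 0, (referenceMap_mem_domain_iff hT).2 fun _ => by simp⟩

theorem isCompact_closure_domain (d : ℕ) (T : ℝ) : IsCompact (closure (domain d T)) := by
  rw [domain, spatialDomain_eq_pi]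
  exact ((Bornology.IsBounded.pi fun _ => Metric.isBounded_Ioo _ _).prod
    (Metric.isBounded_Ioo _ _)).isCompact_closure

theorem volume_domain_ne_zero (d : ℕ) (hT : 0 < T) : volume (domain d T) ≠ 0 :=
  ((isOpen_domain d T).measure_pos volume (domain_nonempty d hT)).ne'

theorem volume_domain_ne_top (d : ℕ) (T : ℝ) : volume (domain d T) ≠ ⊤ :=
  ((measure_mono subset_closure).trans_lt (isCompact_closure_domain d T).measure_lt_top).ne

/-- The uniform distribution on `Ω × (0, T)`, as the image of the one on the reference cube. -/
def domainLaw (d : ℕ) (T : ℝ) : ProbabilityMeasure (SpaceTime d) :=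
  (ProbabilityMeasure.pi fun _ => uniformLaw).map
    (continuous_referenceMap d T).measurable.aemeasurable

/-- The distribution of the points of the Legendre grid of degree `n` on `Ω × (0, T)`, weighted by
products of Gauss–Legendre weights. -/
def gridLaw (d : ℕ) (T : ℝ) (n : ℕ) : ProbabilityMeasure (SpaceTime d) :=
  (ProbabilityMeasure.pi fun _ => gaussLegendreLaw n).map
    (continuous_referenceMap d T).measurable.aemeasurable

theorem tendsto_gridLaw (d : ℕ) (T : ℝ) : Tendsto (gridLaw d T) atTop (𝓝 (domainLaw d T)) :=
  ProbabilityMeasure.tendsto_map_of_tendsto_of_continuous _ _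
    ((ProbabilityMeasure.continuous_pi.tendsto _).comp
      (tendsto_pi_nhds.2 fun _ => tendsto_gaussLegendreLaw)) (continuous_referenceMap d T)

theorem domainLaw_eq_cond (d : ℕ) (hT : 0 < T) :
    (domainLaw d T : Measure (SpaceTime d)) = volume[|domain d T] := by
  have hpreimage : referenceMap T ⁻¹' domain d T = Set.univ.pi fun _ => Set.Ioo (-1 : ℝ) 1 := by
    ext y
    simp only [Set.mem_preimage, referenceMap_mem_domain_iff hT, Set.mem_univ_pi]
  have hscale : ENNReal.ofReal |(T / 2)⁻¹| ≠ 0 := by positivity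
  calc (domainLaw d T : Measure (SpaceTime d))
      = (Measure.pi fun _ => volume[|Set.Ioo (-1 : ℝ) 1]).map (referenceMap T) := rfl
    _ = (volume[|referenceMap T ⁻¹' domain d T]).map (referenceMap T) := by
        rw [pi_cond _ (fun _ => measurableSet_Ioo) (by simp) (by simp), hpreimage, volume_pi]
    _ = volume[|domain d T] := by
        rw [← cond_map _ (continuous_referenceMap d T).measurable
          (isOpen_domain d T).measurableSet, map_referenceMap_volume d hT,
          cond_smul _ hscale ENNReal.ofReal_ne_top]

theorem gridLaw_eq_map (d : ℕ) (T : ℝ) (n : ℕ) : (gridLaw d T n : Measure (SpaceTime d)) =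
    (Measure.pi fun _ => nodeLaw n).map (gridPoint T n) := by
  have hpi : (Measure.pi fun _ : Fin (d + 1) => (nodeLaw n).map (legendreNode n)) =
      (Measure.pi fun _ => nodeLaw n).map fun α i => legendreNode n (α i) :=
    (Measure.pi_map_pi fun _ => (measurable_of_countable _).aemeasurable).symm
  calc (gridLaw d T n : Measure (SpaceTime d))
      = (Measure.pi fun _ => (nodeLaw n).map (legendreNode n)).map (referenceMap T) := rfl
    _ = (Measure.pi fun _ => nodeLaw n).map (gridPoint T n) := by
        rw [hpi, Measure.map_map (continuous_referenceMap d T).measurable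
          (measurable_of_countable _)]
        rfl

theorem ae_gridLaw_mem_domain (hT : 0 < T) (n : ℕ) :
    ∀ᵐ p ∂(gridLaw d T n : Measure (SpaceTime d)), p ∈ domain d T := by
  rw [gridLaw_eq_map]
  exact (ae_map_iff (measurable_of_countable _).aemeasurable (isOpen_domain d T).measurableSet).2
    (ae_of_all _ fun α => (referenceMap_mem_domain_iff hT).2 fun i => legendreNode_mem_Ioo n (α i))

theorem aemeasurable_gridLaw (T : ℝ) (n : ℕ) (f : SpaceTime d → ℝ) :
    AEMeasurable f (gridLaw d T n : Measure (SpaceTime d)) := by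
  rw [gridLaw_eq_map]
  exact aemeasurable_map_of_countable _ (measurable_of_countable _) f

theorem integral_gridLaw (T : ℝ) (n : ℕ) (f : SpaceTime d → ℝ) :
    ∫ p, f p ∂(gridLaw d T n : Measure (SpaceTime d)) =
      ∑ α : MultiIndex n (d + 1), (∏ i, nodeWeight n (α i)) * f (gridPoint T n α) := by
  rw [gridLaw_eq_map, integral_map_of_fintype]
  simp only [measureReal_def, Measure.pi_singleton, ENNReal.toReal_prod]
  simp only [← measureReal_def, nodeLaw_real_singleton]

theorem continuous_lagrangeBasis (T : ℝ) (n : ℕ) (α : MultiIndex n (d + 1)) :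
    Continuous (lagrangeBasis T n α) := by
  unfold lagrangeBasis
  fun_prop

theorem lagrangeBasis_referenceMap (hT : T ≠ 0) (n : ℕ) (α : MultiIndex n (d + 1))
    (y : Fin (d + 1) → ℝ) : lagrangeBasis T n α (referenceMap T y) =
      ∏ i, (Lagrange.basis Finset.univ (legendreNode n) (α i)).eval (y i) := by
  have htime : timeNode T n = fun j => T / 2 * legendreNode n j + T / 2 :=
    funext fun j => by rw [timeNode, mul_add, mul_one]
  simp only [lagrangeBasis, referenceMap, Fin.prod_univ_castSucc, htime, mul_add, mul_one,
    eval_basis_affine _ _ _ (div_ne_zero hT two_ne_zero)]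

theorem setIntegral_domain (hT : 0 < T) (f : SpaceTime d → ℝ) :
    ∫ p in domain d T, f p =
      volume.real (domain d T) * ∫ p, f p ∂(domainLaw d T : Measure (SpaceTime d)) := by
  rw [domainLaw_eq_cond d hT, measureReal_mul_integral_cond (volume_domain_ne_zero d hT)
    (volume_domain_ne_top d T)]

theorem legendreWeight_eq (hT : 0 < T) (n : ℕ) (α : MultiIndex n (d + 1)) :
    legendreWeight T n α = volume.real (domain d T) * ∏ i, nodeWeight n (α i) := by
  rw [legendreWeight, setIntegral_domain hT]
  congr 1
  calc ∫ p, lagrangeBasis T n α p ^ 2 ∂(domainLaw d T : Measure (SpaceTime d))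
      = ∫ y, lagrangeBasis T n α (referenceMap T y) ^ 2 ∂Measure.pi fun _ => ↑uniformLaw :=
        integral_map (continuous_referenceMap d T).measurable.aemeasurable
          ((continuous_lagrangeBasis T n α).pow 2).aestronglyMeasurable
    _ = ∫ y, ∏ i, (Lagrange.basis Finset.univ (legendreNode n) (α i) ^ 2).eval (y i)
          ∂Measure.pi fun _ => ↑uniformLaw := by
        simp only [lagrangeBasis_referenceMap hT.ne', ← Finset.prod_pow, eval_pow]
    _ = ∏ i, nodeWeight n (α i) :=
        integral_fintype_prod_eq_prod fun i x =>
          (Lagrange.basis Finset.univ (legendreNode n) (α i) ^ 2).eval x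

theorem sum_legendreWeight_mul (hT : 0 < T) (n : ℕ) (f : SpaceTime d → ℝ) :
    ∑ α, legendreWeight T n α * f (gridPoint T n α) =
      volume.real (domain d T) * ∫ p, f p ∂(gridLaw d T n : Measure (SpaceTime d)) := by
  simp only [integral_gridLaw, legendreWeight_eq hT, Finset.mul_sum, mul_assoc]

theorem ae_domainLaw_iff (hT : 0 < T) {q : SpaceTime d → Prop} :
    (∀ᵐ p ∂(domainLaw d T : Measure (SpaceTime d)), q p) ↔
      ∀ᵐ p ∂volume.restrict (domain d T), q p := by
  rw [domainLaw_eq_cond d hT, ProbabilityTheory.cond,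
    Measure.ae_ennreal_smul_measure_iff (ENNReal.inv_ne_zero.2 (volume_domain_ne_top d T))]

theorem tendsto_sum_legendreWeight_mul (hT : 0 < T) {f : SpaceTime d → ℝ} {M : ℝ}
    (hf : ∀ᵐ p ∂volume.restrict (domain d T), ContinuousAt f p)
    (hM : ∀ p ∈ domain d T, |f p| ≤ M) :
    Tendsto (fun n => ∑ α, legendreWeight T n α * f (gridPoint T n α)) atTop
      (𝓝 (∫ p in domain d T, f p)) := by
  simp only [sum_legendreWeight_mul hT, setIntegral_domain hT]
  refine Tendsto.const_mul _ (tendsto_integral_of_tendsto_of_ae_continuousAt (M := M)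
    (tendsto_gridLaw d T) (fun n => aemeasurable_gridLaw T n f) ((ae_domainLaw_iff hT).2 hf)
    (fun n => (ae_gridLaw_mem_domain hT n).mono hM) ((ae_domainLaw_iff hT).2 ?_))
  exact ae_restrict_of_forall_mem (isOpen_domain d T).measurableSet hM

end Grid

/-! ### The reconstruction losses -/

theorem measure_prod_graph_eq_zero {X Y : Type*} [MeasurableSpace X] [MeasurableSpace Y]
    [MeasurableEq Y] (μ : Measure X) (ν : Measure Y) [SFinite ν]
    [NullSingletonClass ν] {f : X → Y} (hf : Measurable f) : μ.prod ν {p | p.2 = f p.1} = 0 := by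
  have hgraph : MeasurableSet {p : X × Y | p.2 = f p.1} :=
    measurableSet_eq_fun measurable_snd (hf.comp measurable_fst)
  exact (Measure.measure_prod_null hgraph).2 (ae_of_all _ fun x => measure_singleton (f x))

section Loss

variable {d k m : ℕ} {T : ℝ}

theorem continuous_smoothPart (T : ℝ) (θ : MultiIndex k (d + 1) → ℝ) :
    Continuous (smoothPart T θ) := by
  unfold smoothPart chebyshevBasis
  fun_prop

theorem continuous_shock (C : MultiIndex m d → ℝ) : Continuous (shock C) := by
  unfold shock
  fun_prop

theorem rightRegion_eq_compl (C : MultiIndex m d → ℝ) : rightRegion C = (leftRegion C)ᶜ := by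
  ext p
  exact (not_le (a := p.2)).symm

theorem volume_frontier_leftRegion (C : MultiIndex m d → ℝ) :
    volume (frontier (leftRegion C)) = 0 :=
  measure_mono_null
    (frontier_le_subset_eq continuous_snd ((continuous_shock C).comp continuous_fst))
    (measure_prod_graph_eq_zero volume volume (continuous_shock C).measurable)

theorem ae_continuousAt_heaviside (C : MultiIndex m d → ℝ) :
    ∀ᵐ p : SpaceTime d, ContinuousAt (heaviside C) p := by
  filter_upwards [compl_mem_ae_iff.2 (volume_frontier_leftRegion C)] with p hp
  exact continuousOn_const.continuousAt_indicator hp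

theorem ae_continuousAt_hybridSurrogate (T : ℝ) (θ : MultiIndex k (d + 1) → ℝ) (β : ℝ)
    (C : MultiIndex m d → ℝ) : ∀ᵐ p : SpaceTime d, ContinuousAt (hybridSurrogate T θ β C) p := by
  filter_upwards [ae_continuousAt_heaviside C] with p hp
  exact (continuous_smoothPart T θ).continuousAt.add (continuousAt_const.mul hp)

theorem abs_heaviside_le_one (C : MultiIndex m d → ℝ) (p : SpaceTime d) : |heaviside C p| ≤ 1 := by
  by_cases hp : p ∈ leftRegion C <;> simp [heaviside, hp]

theorem exists_forall_abs_hybridSurrogate_le (T : ℝ) (θ : MultiIndex k (d + 1) → ℝ) (β : ℝ)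
    (C : MultiIndex m d → ℝ) : ∃ B, ∀ p ∈ domain d T, |hybridSurrogate T θ β C p| ≤ B := by
  obtain ⟨B, hB⟩ := (isCompact_closure_domain d T).exists_bound_of_continuousOn
    (continuous_smoothPart T θ).continuousOn
  refine ⟨B + |β|, fun p hp => (abs_add_le _ _).trans (add_le_add (hB p (subset_closure hp)) ?_)⟩
  rw [abs_mul]
  exact mul_le_of_le_one_right (abs_nonneg β) (abs_heaviside_le_one C p)

theorem exists_forall_abs_sq_residual_le {g : SpaceTime d → ℝ}
    (hgb : ∃ M : ℝ, ∀ p ∈ domain d T, |g p| ≤ M) (θ : MultiIndex k (d + 1) → ℝ) (β : ℝ)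
    (C : MultiIndex m d → ℝ) :
    ∃ B, ∀ p ∈ domain d T, |(hybridSurrogate T θ β C p - g p) ^ 2| ≤ B := by
  obtain ⟨M, hM⟩ := hgb
  obtain ⟨B, hB⟩ := exists_forall_abs_hybridSurrogate_le T θ β C
  refine ⟨(B + M) ^ 2, fun p hp => ?_⟩
  rw [abs_pow]
  gcongr
  exact (abs_sub _ _).trans (add_le_add (hB p hp) (hM p hp))

theorem ae_continuousAt_sq_residual {g : SpaceTime d → ℝ}
    (hg : ∀ᵐ p ∂volume.restrict (domain d T), ContinuousAt g p) (θ : MultiIndex k (d + 1) → ℝ)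
    (β : ℝ) (C : MultiIndex m d → ℝ) : ∀ᵐ p ∂volume.restrict (domain d T),
      ContinuousAt (fun q => (hybridSurrogate T θ β C q - g q) ^ 2) p := by
  filter_upwards [hg, ae_restrict_of_ae (ae_continuousAt_hybridSurrogate T θ β C)] with p hgp hψ
  exact (hψ.sub hgp).pow 2

theorem loss_eq_setIntegral {g : SpaceTime d → ℝ} {θ : MultiIndex k (d + 1) → ℝ} {β : ℝ}
    {C : MultiIndex m d → ℝ}
    (h : IntegrableOn (fun p => (hybridSurrogate T θ β C p - g p) ^ 2) (domain d T)) :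
    loss T g θ β C = ∫ p in domain d T, (hybridSurrogate T θ β C p - g p) ^ 2 :=
  (setIntegral_prod _ h).symm

theorem weightedForm_eq_sum (T : ℝ) (n : ℕ) (U : Set (SpaceTime d)) (r : RegionIndex T n U → ℝ) :
    weightedForm T n U r = ∑ α, legendreWeight T n α.1 * r α ^ 2 := by
  simp only [weightedForm, weightMatrix, dotProduct, Matrix.mulVec_diagonal]
  exact Finset.sum_congr rfl fun α _ => by ring

theorem residual_apply (T : ℝ) (g : SpaceTime d → ℝ) (n : ℕ) (U : Set (SpaceTime d))
    (θ : MultiIndex k (d + 1) → ℝ) (b : ℝ) (α : RegionIndex T n U) :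
    residual T g n U θ b α = smoothPart T θ (gridPoint T n α) + b - g (gridPoint T n α) := by
  simp [residual, vandermonde, Matrix.mulVec, dotProduct, smoothPart, mul_comm]

theorem sum_regionIndex_add_sum_regionIndex_compl (T : ℝ) (n : ℕ) (U : Set (SpaceTime d))
    (F : MultiIndex n (d + 1) → ℝ) :
    ∑ α : RegionIndex T n U, F α + ∑ α : RegionIndex T n Uᶜ, F α = ∑ α, F α := by
  classical
  convert Fintype.sum_subtype_add_sum_subtype (fun α => gridPoint T n α ∈ U) F

theorem discreteLoss_eq_sum (T : ℝ) (g : SpaceTime d → ℝ) (n : ℕ)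
    (θ : MultiIndex k (d + 1) → ℝ) (β : ℝ) (C : MultiIndex m d → ℝ) :
    discreteLoss T g n θ β C = ∑ α, legendreWeight T n α *
      (hybridSurrogate T θ β C (gridPoint T n α) - g (gridPoint T n α)) ^ 2 := by
  have hleft (α : RegionIndex T n (leftRegion C)) : residual T g n (leftRegion C) θ β α =
      hybridSurrogate T θ β C (gridPoint T n α) - g (gridPoint T n α) := by
    simp [residual_apply, hybridSurrogate, heaviside, α.2]
  have hright (α : RegionIndex T n (leftRegion C)ᶜ) : residual T g n (leftRegion C)ᶜ θ 0 α =
      hybridSurrogate T θ β C (gridPoint T n α) - g (gridPoint T n α) := by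
    simp [residual_apply, hybridSurrogate, heaviside, Set.indicator_of_notMem α.2]
  rw [discreteLoss, rightRegion_eq_compl]
  simp only [weightedForm_eq_sum, hleft, hright]
  exact sum_regionIndex_add_sum_regionIndex_compl T n (leftRegion C) fun α =>
    legendreWeight T n α *
      (hybridSurrogate T θ β C (gridPoint T n α) - g (gridPoint T n α)) ^ 2

end Loss

end HybridSurrogate

end

theorem mainTheorem3_general (d k m : ℕ) (T : ℝ) (hT : 0 < T)
    (θ : HybridSurrogate.MultiIndex k (d + 1) → ℝ) (β : ℝ)
    (C : HybridSurrogate.MultiIndex m d → ℝ)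
    (g : HybridSurrogate.SpaceTime d → ℝ)
    (hg : ∀ᵐ p ∂MeasureTheory.volume.restrict (HybridSurrogate.domain d T), ContinuousAt g p)
    (hgb : ∃ M : ℝ, ∀ p ∈ HybridSurrogate.domain d T, |g p| ≤ M) :
    MeasureTheory.IntegrableOn
      (fun p => (HybridSurrogate.hybridSurrogate T θ β C p - g p) ^ 2)
      (HybridSurrogate.domain d T) ∧
    Filter.Tendsto (fun n : ℕ => HybridSurrogate.discreteLoss T g n θ β C)
      Filter.atTop (nhds (HybridSurrogate.loss T g θ β C)) := by
  obtain ⟨B, hbound⟩ := HybridSurrogate.exists_forall_abs_sq_residual_le hgb θ β C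
  have hcont := HybridSurrogate.ae_continuousAt_sq_residual hg θ β C
  have hint := HybridSurrogate.integrableOn_of_ae_continuousAt
    (HybridSurrogate.isOpen_domain d T).measurableSet (HybridSurrogate.volume_domain_ne_top d T)
    hcont hbound
  refine ⟨hint, ?_⟩
  simp only [HybridSurrogate.discreteLoss_eq_sum, HybridSurrogate.loss_eq_setIntegral hint]
  exact HybridSurrogate.tendsto_sum_legendreWeight_mul hT hcont hbound

theorem mainTheorem3 (d k m : ℕ) (T : ℝ) (hT : 0 < T)
    (θ : HybridSurrogate.MultiIndex k (d + 1) → ℝ) (β : ℝ)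
    (C : HybridSurrogate.MultiIndex m d → ℝ)
    (g : HybridSurrogate.SpaceTime d → ℝ)
    (hg : ContinuousOn g (HybridSurrogate.domain d T))
    (hgb : ∃ M : ℝ, ∀ p ∈ HybridSurrogate.domain d T, |g p| ≤ M) :
    MeasureTheory.IntegrableOn
      (fun p => (HybridSurrogate.hybridSurrogate T θ β C p - g p) ^ 2)
      (HybridSurrogate.domain d T) ∧
    Filter.Tendsto (fun n : ℕ => HybridSurrogate.discreteLoss T g n θ β C)
      Filter.atTop (nhds (HybridSurrogate.loss T g θ β C)) :=
  mainTheorem3_general d k m T hT θ β C g (MeasureTheory.ae_restrict_of_forall_mem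
    (HybridSurrogate.isOpen_domain d T).measurableSet fun _ hp =>
      hg.continuousAt ((HybridSurrogate.isOpen_domain d T).mem_nhds hp)) hgb
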